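/- Poisson topic model. Let $d,T\in\mathbb N$. A label $y\in\{0,1\}$ has a Bernoulli distribution; given $y$, a topic $\tau\in\{1,\dots,T\}$ is drawn from a distribution $\rho_y$; given $\tau$, the word counts $x_1,\dots,x_d$ are independent (and independent of $y$) with $x_j\sim\mathrm{Poisson}(\lambda_j^{(\tau)})$, $\lambda_j^{(\tau)}\in[0,\infty)$. For $\delta\in(0,1)$ the dropout vector $\tilde x$ has, given $(y,\tau,x)$, independent coordinates $\tilde x_j\sim\mathrm{Binom}(x_j,1-\delta)$. Let $\lambda=\min_\tau\|\lambda^{(\tau)}\|_1$, let $\pi^{(\tau)}=\lambda^{(\tau)}/\|\lambda^{(\tau)}\|_1$, and let $\Pi=(\pi^{(1)},\dots,\pi^{(T)})\in\mathbb R^{d\times T}$. For $w\in\mathbb R^d$ let $\mathrm{Err}_\delta(w)=\mathbb P[y\neq \mathbf 1\{w\cdot\tilde x>0\}]$, let $c_\tau\in\arg\max_{c}\mathbb P[y=c\mid\tau]$, and let $\mathrm{Err}_{\min}=\mathbb P[y\neq c_\tau]$ be the error of the rule that sees the topic. For $0<\kappa<\infty$ call $w$ $\kappa$-well-balanced if for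 every topic $\tau$ $$\frac{\max_j w_j^2\,\sum_{j}\lambda_j^{(\tau)}}{\sum_{j}\lambda^{(\tau)}_jw_j^2}\le\kappa$$ (with nonzero denominator). Suppose that $\Pi$ has rank $T$ and that its smallest singular value satisfies $$\sigma_{\min}(\Pi)\ \ge\ \sqrt{\frac{T}{(1-\delta)\lambda}}\left(1+\sqrt{\log_+\frac{\lambda}{2\pi}}\right),\qquad \log_+=\max(0,\log).$$ Then the distinct-topics condition $\mathrm{Err}_\delta(h^*_\delta)=\mathrm{Err}_{\min}+O(1/\sqrt\lambda)$ holds for the best linear rule $h_\delta^*$. Precisely, there is an absolute constant $C$ (independent of $d$, $T$, $\delta$, $\kappa$ and the model) such that $$\Bigl|\inf_{w\in W}\mathrm{Err}_\delta(w)-\mathrm{Err}_{\min}\Bigr|\le \frac{C}{\sqrt\lambda},$$ and $|\mathrm{Err}_\delta(w^*)-\mathrm{Err}_{\min}|\le C/\sqrt\lambda$ for every minimizer $w^*$ of $\mathrm{Err}_\delta$ over $W$, in each of the following cases: (i) $W=\mathbb R^d$; (ii) $W$ is the set of $\kappa$-well-balanced weight vectors, where $\kappa\ge T/\sigma_{\min}(\Pi)^2$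 or some minimizer of $\mathrm{Err}_\delta$ over all of $\mathbb R^d$ is $\kappa$-well-balanced. (In case (ii) the set $W$ is nonempty.) -/

import Mathlib

open MeasureTheory ProbabilityTheory
open scoped NNReal

/-- A Poisson topic model with `d` words and finitely many topics `0, …, T - 1`:
the Bernoulli law of the label, the topic distribution `ρ_y` given each label `y`, and the expected
number `rate τ j` of occurrences of word `j` in a document with topic `τ`. -/
structure PoissonTopicModel (d T : ℕ) where
  labelDist : PMF Bool
  topicDist : Bool → PMF (Fin T)
  rate : Fin T → Fin d → ℝ≥0

/-- A random document: label, topic, word counts, and word counts after dropout. -/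
abbrev Document (d T : ℕ) : Type := Bool × Fin T × (Fin d → ℕ) × (Fin d → ℕ)

namespace Document

variable {d T : ℕ}

def label (ω : Document d T) : Bool := ω.1

def topic (ω : Document d T) : Fin T := ω.2.1

def counts (ω : Document d T) : Fin d → ℕ := ω.2.2.1

def thinned (ω : Document d T) : Fin d → ℕ := ω.2.2.2

end Document

namespace PoissonTopicModel

variable {d T : ℕ} (M : PoissonTopicModel d T) (δ : unitInterval)

/-- Given the topic `τ`, the word counts are independent Poisson variables. -/
noncomputable def countLaw (τ : Fin T) : Measure (Fin d → ℕ) :=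
  Measure.pi fun j => poissonMeasure (M.rate τ j)

/-- Binomial dropout: each occurrence of each word is deleted independently with
probability `δ`. -/
noncomputable def dropoutLaw (x : Fin d → ℕ) : Measure (Fin d → ℕ) :=
  Measure.pi fun j => binomial (x j) (unitInterval.symm δ)

/-- The joint law of label, topic, word counts and thinned word counts: draw the label, then the
topic given the label, then the counts given the topic, then thin the counts. -/
noncomputable def law : Measure (Document d T) :=
  M.labelDist.toMeasure.bind fun y =>
    (M.topicDist y).toMeasure.bind fun τ =>
      (M.countLaw τ).bind fun x =>
        (dropoutLaw δ x).map fun x' => (y, τ, x, x')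

/-- Average length `‖λ^(τ)‖₁` of a document with topic `τ`. -/
noncomputable def topicLength (τ : Fin T) : ℝ := ∑ j, (M.rate τ j : ℝ)

/-- `λ`, the shortest average document length across topics. -/
noncomputable def minLength : ℝ := ⨅ τ, M.topicLength τ

/-- The `d × T` matrix whose columns are the normalized word distributions of the topics. -/
noncomputable def wordMatrix : Matrix (Fin d) (Fin T) ℝ :=
  Matrix.of fun j τ => (M.rate τ j : ℝ) / M.topicLength τ

/-- The smallest of the `T` singular values of the word matrix (Mathlib lists singular values in
decreasing order, starting at index `0`, with one for each dimension of the source). -/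
noncomputable def minSingularValue : ℝ :=
  (Matrix.toEuclideanLin M.wordMatrix).singularValues (T - 1)

/-- `b` is a most likely label given the topic `τ`. -/
def IsMostLikelyLabel (τ : Fin T) (b : Bool) : Prop :=
  ∀ b' : Bool,
    ((M.law δ)[|{ω | ω.topic = τ}]).real {ω | ω.label = b'} ≤
      ((M.law δ)[|{ω | ω.topic = τ}]).real {ω | ω.label = b}

/-- `Err_min`, the error of the rule that sees the topic `τ` and predicts `c τ`. -/
noncomputable def errMin (c : Fin T → Bool) : ℝ :=
  (M.law δ).real {ω | ω.label ≠ c ω.topic}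

/-- The linear decision rule `𝟙{w · x > 0}`. -/
noncomputable def linearRule (w : Fin d → ℝ) (x : Fin d → ℕ) : Bool :=
  decide (0 < ∑ j, w j * (x j : ℝ))

/-- `Err_δ`, the error of the linear rule with weights `w` under the dropout measure. -/
noncomputable def dropoutErr (w : Fin d → ℝ) : ℝ :=
  (M.law δ).real {ω | ω.label ≠ linearRule w ω.thinned}

/-- The weights `w` are well-balanced with constant `κ`. -/
def WellBalanced (κ : ℝ) (w : Fin d → ℝ) : Prop :=
  ∀ τ, 0 < ∑ j, (M.rate τ j : ℝ) * w j ^ 2 ∧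
    (⨆ j, w j ^ 2) * (∑ j, (M.rate τ j : ℝ)) / (∑ j, (M.rate τ j : ℝ) * w j ^ 2) ≤ κ

/-- The best linear rule `h*_δ` with weights in `W` satisfies
`|Err_δ(h*_δ) - Err_min| ≤ C / √λ`. The minimum of the dropout error over `W` need not be attained,
so this is said both of the greatest lower bound (whose existence is part of the claim) and of every
minimizer. -/
def DistinctTopics (c : Fin T → Bool) (W : Set (Fin d → ℝ)) (C : ℝ) : Prop :=
  (∃ e : ℝ, IsGLB (M.dropoutErr δ '' W) e ∧
      |e - M.errMin δ c| ≤ C / √M.minLength) ∧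
    ∀ w ∈ W, IsMinOn (M.dropoutErr δ) W w →
      |M.dropoutErr δ w - M.errMin δ c| ≤ C / √M.minLength

end PoissonTopicModel

/-! Given the topic, label and words are independent, so no rule on `x̃` beats the rule that sees
the topic: `errMin_le_dropoutErr`. It remains to find a single good weight vector in `W`.

Let `s τ = ±1` encode `c τ` and let `w` be the minimal-norm solution of `Πᵀ w = s`, so that `max_j
w_j² ≤ ‖w‖² ≤ T / σ_min²` (`Matrix.exists_transpose_mulVec_eq`). Under topic `τ` the score `w · x̃`
has mean `(1 - δ) s τ ‖λ^(τ)‖₁`, and a Chernoff bound (`thinnedLaw_real_sum_nonpos_le`) gives it the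
wrong sign with probability at most `exp (-(1 - δ) λ σ_min² / (2 T))`. The singular value condition
makes this at most `√(2π / λ)`, whence `C = √(2π)`. Cauchy–Schwarz shows that the same `w` is
well-balanced with constant `T / σ_min²`. -/

namespace PoissonTopicModel

/-! ### Errors as sums over topics -/

variable {d T : ℕ} (M : PoissonTopicModel d T) (δ : unitInterval)

instance isProbabilityMeasure_countLaw (τ : Fin T) : IsProbabilityMeasure (M.countLaw τ) := by
  unfold countLaw; infer_instance

instance isProbabilityMeasure_dropoutLaw (x : Fin d → ℕ) :
    IsProbabilityMeasure (dropoutLaw δ x) := by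
  unfold dropoutLaw; infer_instance

/-- The law of the thinned word counts given the topic. -/
noncomputable def thinnedLaw (τ : Fin T) : Measure (Fin d → ℕ) :=
  (M.countLaw τ).bind (dropoutLaw δ)

instance isProbabilityMeasure_thinnedLaw (τ : Fin T) :
    IsProbabilityMeasure (M.thinnedLaw δ τ) :=
  isProbabilityMeasure_bind Measurable.of_discrete.aemeasurable (ae_of_all _ fun _ => inferInstance)

/-- The joint probability of a label and a topic. -/
noncomputable def jointProb (y : Bool) (τ : Fin T) : ℝ :=
  (M.labelDist y).toReal * (M.topicDist y τ).toReal

lemma jointProb_nonneg (y : Bool) (τ : Fin T) : 0 ≤ M.jointProb y τ := by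
  unfold jointProb; positivity

/-- Letting the event depend on label and topic covers both error probabilities and the total mass
at once. -/
lemma law_thinned_mem (A : Bool → Fin T → Set (Fin d → ℕ)) :
    M.law δ {ω | ω.thinned ∈ A ω.label ω.topic} =
      ∑ y, M.labelDist y * ∑ τ, M.topicDist y τ * M.thinnedLaw δ τ (A y τ) := by
  unfold law
  rw [Measure.bind_apply .of_discrete Measurable.of_discrete.aemeasurable, lintegral_fintype]
  refine Finset.sum_congr rfl fun y _ => ?_
  rw [PMF.toMeasure_apply_singleton _ _ (.of_discrete), mul_comm,
    Measure.bind_apply .of_discrete Measurable.of_discrete.aemeasurable, lintegral_fintype]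
  congr 1
  refine Finset.sum_congr rfl fun τ _ => ?_
  rw [PMF.toMeasure_apply_singleton _ _ (.of_discrete), mul_comm,
    Measure.bind_apply .of_discrete Measurable.of_discrete.aemeasurable, thinnedLaw,
    Measure.bind_apply .of_discrete Measurable.of_discrete.aemeasurable]
  congr 1
  refine lintegral_congr fun x => ?_
  rw [Measure.map_apply Measurable.of_discrete .of_discrete]
  rfl

lemma law_real_thinned_mem (A : Bool → Fin T → Set (Fin d → ℕ)) :
    (M.law δ).real {ω | ω.thinned ∈ A ω.label ω.topic} =
      ∑ τ, ∑ y, M.jointProb y τ * (M.thinnedLaw δ τ).real (A y τ) := by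
  have h (y : Bool) (τ : Fin T) : M.topicDist y τ * M.thinnedLaw δ τ (A y τ) ≠ ⊤ :=
    ENNReal.mul_ne_top (PMF.apply_ne_top _ _) (measure_ne_top _ _)
  rw [Measure.real, law_thinned_mem, ENNReal.toReal_sum, Finset.sum_comm]
  · refine Finset.sum_congr rfl fun y _ => ?_
    rw [ENNReal.toReal_mul, ENNReal.toReal_sum fun τ _ => h y τ, Finset.mul_sum]
    refine Finset.sum_congr rfl fun τ _ => ?_
    rw [ENNReal.toReal_mul, jointProb, Measure.real, mul_assoc]
  · exact fun y _ => ENNReal.mul_ne_top (PMF.apply_ne_top _ _)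
      (ENNReal.sum_ne_top.2 fun τ _ => h y τ)

instance isProbabilityMeasure_law : IsProbabilityMeasure (M.law δ) := by
  constructor
  have h := M.law_thinned_mem δ fun _ _ => Set.univ
  have h' (p : PMF Bool) : ∑ y, p y = 1 := (tsum_fintype _).symm.trans p.tsum_coe
  have h'' (p : PMF (Fin T)) : ∑ y, p y = 1 := (tsum_fintype _).symm.trans p.tsum_coe
  simpa only [Set.mem_univ, Set.ofPred_true, measure_univ, mul_one, h', h''] using h

lemma sum_jointProb : ∑ τ, ∑ y, M.jointProb y τ = 1 := by
  have h := M.law_real_thinned_mem 0 fun _ _ => Set.univ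
  simpa only [Set.mem_univ, Set.ofPred_true, probReal_univ, mul_one, eq_comm] using h

lemma law_real_label_topic (P : Bool → Fin T → Prop) [∀ y τ, Decidable (P y τ)] :
    (M.law δ).real {ω | P ω.label ω.topic} =
      ∑ τ, ∑ y, if P y τ then M.jointProb y τ else 0 := by
  have h := M.law_real_thinned_mem δ fun y τ => {_x | P y τ}
  refine Eq.trans h (Finset.sum_congr rfl fun τ _ => Finset.sum_congr rfl fun y _ => ?_)
  by_cases hP : P y τ <;> simp [hP]

lemma errMin_eq_sum (c : Fin T → Bool) : M.errMin δ c = ∑ τ, M.jointProb (!c τ) τ := by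
  rw [errMin, M.law_real_label_topic δ fun y τ => y ≠ c τ]
  refine Finset.sum_congr rfl fun τ _ => ?_
  cases c τ <;> simp

/-- Relative to `c`, disagreeing on topic `τ` costs the gap between the joint probabilities of the
two labels; both the lower and the upper bound on the error follow from this form. -/
lemma dropoutErr_eq_sum (c : Fin T → Bool) (w : Fin d → ℝ) :
    M.dropoutErr δ w = ∑ τ, (M.jointProb (!c τ) τ +
      (M.thinnedLaw δ τ).real {x | linearRule w x ≠ c τ} *
        (M.jointProb (c τ) τ - M.jointProb (!c τ) τ)) := by
  rw [dropoutErr]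
  refine (M.law_real_thinned_mem δ fun y _ => {x | y ≠ linearRule w x}).trans
    (Finset.sum_congr rfl fun τ _ => ?_)
  have h := probReal_compl_eq_one_sub (μ := M.thinnedLaw δ τ)
    (MeasurableSet.of_discrete (s := {x | linearRule w x ≠ true}))
  have h' : {x : Fin d → ℕ | linearRule w x ≠ true}ᶜ = {x | linearRule w x ≠ false} := by
    ext; simp
  rw [h'] at h
  simp only [Fintype.sum_bool, ne_comm (b := linearRule w _)]
  cases c τ <;> simp only [h, Bool.not_true, Bool.not_false] <;> ring

variable {δ}

lemma IsMostLikelyLabel.jointProb_le {τ : Fin T} {b : Bool} (h : M.IsMostLikelyLabel δ τ b)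
    (b' : Bool) : M.jointProb b' τ ≤ M.jointProb b τ := by
  have hj (y : Bool) : (M.law δ).real ({ω | ω.topic = τ} ∩ {ω | ω.label = y}) =
      M.jointProb y τ := by
    refine (M.law_real_label_topic δ fun z σ => σ = τ ∧ z = y).trans ?_
    simp [ite_and]
  have hle (y : Bool) : M.jointProb y τ ≤ (M.law δ).real {ω | ω.topic = τ} := by
    rw [← hj]; exact measureReal_mono Set.inter_subset_left
  have h := h b'
  rw [measureReal_def, measureReal_def, cond_apply .of_discrete, cond_apply .of_discrete,
    ENNReal.toReal_mul, ENNReal.toReal_mul, ENNReal.toReal_inv] at h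
  simp only [← measureReal_def, hj] at h
  -- On a null topic conditioning gives the zero measure and `h` is vacuous, but then both joint
  -- probabilities vanish.
  rcases (measureReal_nonneg (μ := M.law δ) (s := {ω | ω.topic = τ})).eq_or_lt with h0 | h0
  · have := hle b'
    have := M.jointProb_nonneg b τ
    linarith
  · exact le_of_mul_le_mul_left h (inv_pos.2 h0)

lemma errMin_le_dropoutErr {c : Fin T → Bool} (hc : ∀ τ, M.IsMostLikelyLabel δ τ (c τ))
    (w : Fin d → ℝ) : M.errMin δ c ≤ M.dropoutErr δ w := by
  rw [errMin_eq_sum, M.dropoutErr_eq_sum δ c]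
  refine Finset.sum_le_sum fun τ _ => le_add_of_nonneg_right ?_
  exact mul_nonneg measureReal_nonneg (sub_nonneg.2 ((hc τ).jointProb_le M _))

lemma dropoutErr_le_errMin_add {c : Fin T → Bool} {w : Fin d → ℝ} {ε : ℝ} (hε : 0 ≤ ε)
    (h : ∀ τ, (M.thinnedLaw δ τ).real {x | linearRule w x ≠ c τ} ≤ ε) :
    M.dropoutErr δ w ≤ M.errMin δ c + ε := by
  rw [errMin_eq_sum, M.dropoutErr_eq_sum δ c, Finset.sum_add_distrib]
  refine add_le_add_right ?_ _
  calc _ ≤ ∑ τ, ε * ∑ y, M.jointProb y τ := by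
        refine Finset.sum_le_sum fun τ _ => ?_
        have h1 := M.jointProb_nonneg (c τ) τ
        have h2 := M.jointProb_nonneg (!c τ) τ
        have h3 : ∑ y, M.jointProb y τ = M.jointProb (c τ) τ + M.jointProb (!c τ) τ := by
          cases c τ <;> simp [add_comm]
        calc _ ≤ (M.thinnedLaw δ τ).real {x | linearRule w x ≠ c τ} * M.jointProb (c τ) τ :=
              mul_le_mul_of_nonneg_left (by linarith) measureReal_nonneg
          _ ≤ ε * M.jointProb (c τ) τ := mul_le_mul_of_nonneg_right (h τ) h1
          _ ≤ _ := mul_le_mul_of_nonneg_left (by linarith) hε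
    _ = ε := by rw [← Finset.mul_sum, sum_jointProb, mul_one]

end PoissonTopicModel

/-! ### Generating functions and the Chernoff bound -/

lemma ProbabilityTheory.lintegral_pow_binomial (n : ℕ) (p : unitInterval) {z : ℝ} (hz : 0 ≤ z) :
    ∫⁻ k, ENNReal.ofReal (z ^ k) ∂binomial n p = ENNReal.ofReal ((1 - p + p * z) ^ n) := by
  rw [← ofReal_integral_eq_lintegral_ofReal (integrable_binomial _)
    (ae_of_all _ fun k => by positivity), integral_binomial, add_comm (1 - (p : ℝ)), add_pow,
    show Finset.Iic n = Finset.range (n + 1) by ext; simp]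
  congr 1
  refine Finset.sum_congr rfl fun k _ => ?_
  rw [smul_eq_mul, mul_pow]
  ring

lemma ProbabilityTheory.lintegral_pow_poissonMeasure (r : ℝ≥0) {q : ℝ} (hq : 0 ≤ q) :
    ∫⁻ n, ENNReal.ofReal (q ^ n) ∂poissonMeasure r = ENNReal.ofReal (Real.exp (r * (q - 1))) := by
  have h : HasSum (fun n : ℕ => q ^ n * (Real.exp (-r) * r ^ n / n.factorial))
      (Real.exp (r * (q - 1))) := by
    have := (NormedSpace.expSeries_div_hasSum_exp ((r : ℝ) * q)).mul_left (Real.exp (-r))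
    rw [← Real.exp_eq_exp_ℝ, ← Real.exp_add] at this
    rw [show (r : ℝ) * (q - 1) = -r + r * q by ring]
    convert! this using 2 with n
    rw [mul_pow]
    ring
  rw [lintegral_countable', ← h.tsum_eq, ENNReal.ofReal_tsum_of_nonneg (fun n => by positivity)
    h.summable]
  refine tsum_congr fun n => ?_
  rw [poissonMeasure_singleton, ENNReal.ofReal_mul (by positivity)]

lemma MeasureTheory.lintegral_pi_prod_eq_prod {ι : Type*} [Fintype ι] {X : ι → Type*}
    [∀ i, MeasurableSpace (X i)] (μ : ∀ i, Measure (X i)) [∀ i, IsProbabilityMeasure (μ i)]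
    {f : ∀ i, X i → ENNReal} (hf : ∀ i, Measurable (f i)) :
    ∫⁻ x, ∏ i, f i (x i) ∂Measure.pi μ = ∏ i, ∫⁻ x, f i x ∂μ i := by
  rw [lintegral_prod_eq_prod_lintegral_of_indepFun _ (fun i (x : ∀ i, X i) => f i (x i))
    (iIndepFun_pi fun i => (hf i).aemeasurable)
    fun i => (hf i).comp (measurable_pi_apply i)]
  refine Finset.prod_congr rfl fun i _ => ?_
  exact (measurePreserving_eval μ i).lintegral_comp (hf i)

namespace PoissonTopicModel

variable {d T : ℕ} (M : PoissonTopicModel d T) (δ : unitInterval)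

/-- This is the generating function of independent Poisson variables with means `(1 - δ) λ_j`. It is
all that is needed of Poisson thinning, so the thinned law itself is never identified. -/
lemma lintegral_prod_pow_thinnedLaw (τ : Fin T) {z : Fin d → ℝ} (hz : ∀ j, 0 ≤ z j) :
    ∫⁻ x, ∏ j, ENNReal.ofReal (z j ^ x j) ∂M.thinnedLaw δ τ =
      ENNReal.ofReal (Real.exp ((1 - δ) * ∑ j, M.rate τ j * (z j - 1))) := by
  have hδ := unitInterval.nonneg δ
  have hδ' := unitInterval.one_minus_nonneg δ
  have hq (j : Fin d) : (0 : ℝ) ≤ δ + (1 - δ) * z j := by have := hz j; positivity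
  rw [thinnedLaw, Measure.lintegral_bind Measurable.of_discrete.aemeasurable
    Measurable.of_discrete.aemeasurable]
  calc _ = ∫⁻ x, ∏ j, ENNReal.ofReal ((δ + (1 - δ) * z j) ^ x j) ∂M.countLaw τ := by
        refine lintegral_congr fun x => ?_
        rw [dropoutLaw, lintegral_pi_prod_eq_prod (f := fun j k => ENNReal.ofReal (z j ^ k)) _
          fun j => Measurable.of_discrete]
        refine Finset.prod_congr rfl fun j _ => ?_
        rw [lintegral_pow_binomial _ _ (hz j), unitInterval.coe_symm_eq, sub_sub_cancel]
    _ = ∏ j, ENNReal.ofReal (Real.exp (M.rate τ j * ((δ + (1 - δ) * z j) - 1))) := by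
        rw [countLaw, lintegral_pi_prod_eq_prod
          (f := fun j k => ENNReal.ofReal (((δ : ℝ) + (1 - δ) * z j) ^ k)) _
          fun j => Measurable.of_discrete]
        exact Finset.prod_congr rfl fun j _ => lintegral_pow_poissonMeasure _ (hq j)
    _ = _ := by
        rw [← ENNReal.ofReal_prod_of_nonneg fun j _ => (Real.exp_pos _).le, ← Real.exp_sum,
          Finset.mul_sum]
        congr 3
        ext j
        ring

/-- Chernoff bound for a bounded linear statistic of the thinned word counts whose mean is the mean
length of the thinned document. -/
lemma thinnedLaw_real_sum_nonpos_le (τ : Fin T) {v : Fin d → ℝ} {b : ℝ} (hb : 0 < b)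
    (hv : ∀ j, |v j| ≤ b) (hmean : ∑ j, M.rate τ j * v j = M.topicLength τ) :
    (M.thinnedLaw δ τ).real {x | ∑ j, v j * (x j : ℝ) ≤ 0} ≤
      Real.exp (-((1 - δ) * M.topicLength τ / (2 * b ^ 2))) := by
  have hδ' := unitInterval.one_minus_nonneg δ
  -- With `e^u = 1 + 1/b`, the quantity `cosh u - 1 - sinh u / b` is exactly `-1 / (2 b²)`.
  set u := Real.log (1 + 1 / b)
  have hu : 0 ≤ u := Real.log_nonneg (by simp [hb.le])
  have heu : Real.exp u = 1 + 1 / b := Real.exp_log (by positivity)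
  set z : Fin d → ℝ := fun j => Real.exp (-(v j / b) * u) with hz
  have hz0 (j : Fin d) : 0 ≤ z j := (Real.exp_pos _).le
  -- The exponent `-(v j / b) u` lies in `[-u, u]`, so the chord of `exp` over this interval bounds
  -- `z j` by an affine function of `v j`; its sum against the rates involves only `topicLength` and
  -- the mean.
  have hconv (j : Fin d) : z j ≤
      (1 + v j / b) / 2 * Real.exp (-u) + (1 - v j / b) / 2 * Real.exp u := by
    have h1 : |v j / b| ≤ 1 := by rw [abs_div, abs_of_pos hb, div_le_one hb]; exact hv j
    obtain ⟨h2, h3⟩ := abs_le.1 h1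
    have := convexOn_exp.2 (Set.mem_univ (-u)) (Set.mem_univ u)
      (by linarith : 0 ≤ (1 + v j / b) / 2) (by linarith : 0 ≤ (1 - v j / b) / 2) (by ring)
    simp only [smul_eq_mul] at this
    refine le_trans (le_of_eq ?_) this
    simp only [hz]
    congr 1
    ring
  have hsum : ∑ j, (M.rate τ j : ℝ) * (z j - 1) ≤ -(M.topicLength τ / (2 * b ^ 2)) := by
    calc _ ≤ ∑ j, ((M.rate τ j : ℝ) * ((Real.exp (-u) + Real.exp u) / 2 - 1) +
          M.rate τ j * v j * ((Real.exp (-u) - Real.exp u) / (2 * b))) := by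
          refine Finset.sum_le_sum fun j _ => ?_
          have := mul_le_mul_of_nonneg_left (sub_le_sub_right (hconv j) 1) (M.rate τ j).coe_nonneg
          refine this.trans (le_of_eq ?_)
          field_simp
          ring
      _ = _ := by
          rw [Finset.sum_add_distrib, ← Finset.sum_mul, ← Finset.sum_mul, hmean,
            ← topicLength, Real.exp_neg, heu]
          field_simp
          ring
  have key : M.thinnedLaw δ τ {x | ∑ j, v j * (x j : ℝ) ≤ 0} ≤
      ENNReal.ofReal (Real.exp ((1 - δ) * ∑ j, M.rate τ j * (z j - 1))) := by
    rw [← M.lintegral_prod_pow_thinnedLaw δ τ hz0, ← lintegral_indicator_one .of_discrete]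
    -- Exponential Markov inequality: the integrand is at least `1` on the event.
    refine lintegral_mono (Set.indicator_le (fun x hx => ?_))
    rw [← ENNReal.ofReal_prod_of_nonneg fun j _ => pow_nonneg (hz0 j) _]
    have : ∏ j, z j ^ x j = Real.exp (-(u / b) * ∑ j, v j * (x j : ℝ)) := by
      rw [Finset.mul_sum, Real.exp_sum]
      refine Finset.prod_congr rfl fun j _ => ?_
      rw [hz, ← Real.exp_nat_mul]
      congr 1
      ring
    rw [this, Pi.one_apply, ENNReal.one_le_ofReal, Real.one_le_exp_iff]
    exact mul_nonneg_of_nonpos_of_nonpos (neg_nonpos.2 (by positivity)) hx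
  refine (ENNReal.toReal_le_of_le_ofReal (Real.exp_pos _).le key).trans (Real.exp_le_exp.2 ?_)
  calc _ ≤ (1 - (δ : ℝ)) * -(M.topicLength τ / (2 * b ^ 2)) :=
        mul_le_mul_of_nonneg_left hsum hδ'
    _ = _ := by ring

end PoissonTopicModel

/-! ### Smallest singular value and the minimal-norm solution -/

section
open Module InnerProductSpace

variable {E F : Type*} [NormedAddCommGroup E] [InnerProductSpace ℝ E] [FiniteDimensional ℝ E]
  [NormedAddCommGroup F] [InnerProductSpace ℝ F] [FiniteDimensional ℝ F]

/-- In an eigenbasis of `A† A`, `‖A x‖²` is the sum of the squared coordinates of `x` weighted by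
the squared singular values, the last of which is the least. -/
lemma LinearMap.singularValues_finrank_sub_one_mul_norm_le (A : E →ₗ[ℝ] F) (x : E) :
    A.singularValues (finrank ℝ E - 1) * ‖x‖ ≤ ‖A x‖ := by
  refine le_of_sq_le_sq ?_ (norm_nonneg _)
  set e := A.isSymmetric_adjoint_comp_self.eigenvectorBasis rfl
  have h1 : ‖A x‖ ^ 2 = ∑ i : Fin (finrank ℝ E), A.singularValues i ^ 2 * (e.repr x i) ^ 2 := by
    rw [← real_inner_self_eq_norm_sq, ← LinearMap.adjoint_inner_right, ← LinearMap.comp_apply,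
      ← e.repr.inner_map_map, PiLp.inner_apply]
    refine Finset.sum_congr rfl fun i _ => ?_
    rw [A.isSymmetric_adjoint_comp_self.eigenvectorBasis_apply_self_apply rfl x i,
      A.sq_singularValues_fin rfl i]
    simp
    ring
  have h2 : ‖x‖ ^ 2 = ∑ i, (e.repr x i) ^ 2 := by
    rw [← e.repr.norm_map, EuclideanSpace.real_norm_sq_eq]
  rw [mul_pow, h1, h2, Finset.mul_sum]
  refine Finset.sum_le_sum fun i _ => mul_le_mul_of_nonneg_right ?_ (sq_nonneg _)
  exact pow_le_pow_left₀ (A.singularValues_nonneg _)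
    (A.singularValues_antitone (Nat.le_sub_one_of_lt i.isLt)) 2

/-- The minimal-norm solution of `A† y = s`. -/
lemma LinearMap.exists_adjoint_apply_eq (A : E →ₗ[ℝ] F) (hA : Function.Injective A) (s : E) :
    ∃ y, A.adjoint y = s ∧ A.singularValues (finrank ℝ E - 1) * ‖y‖ ≤ ‖s‖ := by
  have hG : Function.Injective (A.adjoint ∘ₗ A) := by
    simpa using A.adjoint_comp_self_injective_iff.2 hA
  -- The solution is `y = A (A† A)⁻¹ s`. Then `‖y‖² = ⟪x, s⟫ ≤ ‖x‖ ‖s‖`, while `σ_min ‖x‖ ≤ ‖y‖`.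
  obtain ⟨x, hx⟩ := LinearMap.surjective_of_injective hG s
  rw [LinearMap.comp_apply] at hx
  refine ⟨A x, hx, ?_⟩
  rcases eq_or_ne (A x) 0 with h0 | h0
  · simp [h0]
  refine le_of_mul_le_mul_right ?_ (norm_pos_iff.2 h0)
  calc _ = A.singularValues (finrank ℝ E - 1) * ‖A x‖ ^ 2 := by ring
    _ = A.singularValues (finrank ℝ E - 1) * ⟪x, s⟫_ℝ := by
        rw [← hx, LinearMap.adjoint_inner_right, real_inner_self_eq_norm_sq]
    _ ≤ A.singularValues (finrank ℝ E - 1) * (‖x‖ * ‖s‖) :=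
        mul_le_mul_of_nonneg_left (real_inner_le_norm _ _) (A.singularValues_nonneg _)
    _ = A.singularValues (finrank ℝ E - 1) * ‖x‖ * ‖s‖ := by ring
    _ ≤ ‖A x‖ * ‖s‖ := mul_le_mul_of_nonneg_right
        (A.singularValues_finrank_sub_one_mul_norm_le x) (norm_nonneg _)
    _ = _ := mul_comm _ _

end

lemma Matrix.finrank_range_toEuclideanLin {d T : ℕ} (P : Matrix (Fin d) (Fin T) ℝ) :
    Module.finrank ℝ (toEuclideanLin P).range = P.rank :=
  (P.rank_eq_finrank_range_toLin (PiLp.basisFun 2 ℝ _) (PiLp.basisFun 2 ℝ _)).symm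

lemma Matrix.exists_transpose_mulVec_eq {d T : ℕ} (P : Matrix (Fin d) (Fin T) ℝ)
    (hP : P.rank = T) (s : Fin T → ℝ) :
    ∃ w : Fin d → ℝ, (∀ τ, ∑ j, P j τ * w j = s τ) ∧
      (toEuclideanLin P).singularValues (T - 1) ^ 2 * ∑ j, w j ^ 2 ≤ ∑ τ, s τ ^ 2 := by
  have hinj : Function.Injective (toEuclideanLin P) := by
    rw [← LinearMap.ker_eq_bot, ← Submodule.finrank_eq_zero]
    have := (toEuclideanLin P).finrank_range_add_finrank_ker
    rw [finrank_range_toEuclideanLin, hP, finrank_euclideanSpace_fin] at this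
    omega
  obtain ⟨y, hy, hle⟩ := LinearMap.exists_adjoint_apply_eq _ hinj (WithLp.toLp 2 s)
  refine ⟨y, fun τ => ?_, ?_⟩
  · have h := LinearMap.adjoint_inner_right (toEuclideanLin P) (EuclideanSpace.single τ 1) y
    rw [hy, EuclideanSpace.inner_single_left] at h
    simp only [map_one, one_mul] at h
    rw [h, PiLp.inner_apply]
    refine Finset.sum_congr rfl fun j _ => ?_
    simp [toLpLin_apply, mul_comm]
  · rw [finrank_euclideanSpace_fin] at hle
    have := pow_le_pow_left₀ (mul_nonneg (LinearMap.singularValues_nonneg _ _) (norm_nonneg _)) hle 2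
    rwa [mul_pow, EuclideanSpace.real_norm_sq_eq, EuclideanSpace.real_norm_sq_eq] at this

/-! ### Good weights under the singular value condition -/

namespace PoissonTopicModel

variable {d T : ℕ} {M : PoissonTopicModel d T} {δ : unitInterval}

lemma topicLength_nonneg (τ : Fin T) : 0 ≤ M.topicLength τ :=
  Finset.sum_nonneg fun _ _ => NNReal.coe_nonneg _

lemma minLength_le (τ : Fin T) : M.minLength ≤ M.topicLength τ :=
  ciInf_le (Set.finite_range _).bddBelow τ

lemma nonempty_topic (M : PoissonTopicModel d T) : Nonempty (Fin T) :=
  ⟨(M.topicDist true).support_nonempty.some⟩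

lemma minSingularValue_pos (hrank : M.wordMatrix.rank = T) : 0 < M.minSingularValue := by
  have := M.nonempty_topic
  rw [minSingularValue, LinearMap.singularValues_pos_iff_lt_finrank_range,
    Matrix.finrank_range_toEuclideanLin, hrank]
  exact Nat.sub_one_lt (Fin.pos_iff_nonempty.2 this).ne'

lemma WellBalanced.mono {κ κ' : ℝ} {w : Fin d → ℝ} (h : M.WellBalanced κ w) (hκ : κ ≤ κ') :
    M.WellBalanced κ' w :=
  fun τ => ⟨(h τ).1, (h τ).2.trans hκ⟩

/-- Since `errMin` bounds every error from below, one good member of `W` pins both the infimum and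
any minimum. -/
lemma distinctTopics_of_mem {c : Fin T → Bool} {W : Set (Fin d → ℝ)} {C : ℝ}
    (hc : ∀ τ, M.IsMostLikelyLabel δ τ (c τ)) {w₀ : Fin d → ℝ} (hw₀ : w₀ ∈ W)
    (h : M.dropoutErr δ w₀ ≤ M.errMin δ c + C / √M.minLength) : M.DistinctTopics δ c W C := by
  have hlow (w : Fin d → ℝ) := M.errMin_le_dropoutErr hc w
  have hbdd : M.errMin δ c ∈ lowerBounds (M.dropoutErr δ '' W) := by
    rintro _ ⟨w, -, rfl⟩
    exact hlow w
  refine ⟨⟨_, isGLB_csInf ⟨_, w₀, hw₀, rfl⟩ ⟨_, hbdd⟩, ?_⟩, fun w _ hmin => ?_⟩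
  · have h1 := le_csInf (Set.Nonempty.image (M.dropoutErr δ) ⟨w₀, hw₀⟩) hbdd
    have h2 := csInf_le ⟨_, hbdd⟩ (Set.mem_image_of_mem (M.dropoutErr δ) hw₀)
    rw [abs_of_nonneg (by linarith)]
    linarith
  · have h1 := hlow w
    have h2 : M.dropoutErr δ w ≤ M.dropoutErr δ w₀ := hmin hw₀
    rw [abs_of_nonneg (by linarith)]
    linarith

/-- Under the singular value condition, the Chernoff exponent of the minimal-norm weights is at least
`log_+ (λ / 2π) / 2`. -/
lemma exp_neg_le_of_singular_value_bound {lam L σ t δ : ℝ} (hlam : 0 < lam) (hL : lam ≤ L)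
    (hσ : 0 < σ) (ht : 0 < t) (hδ : δ < 1)
    (h : √(t / ((1 - δ) * lam)) * (1 + √(Real.posLog (lam / (2 * Real.pi)))) ≤ σ) :
    Real.exp (-((1 - δ) * L / (2 * (t / σ ^ 2)))) ≤ √(2 * Real.pi) / √lam := by
  have hδ' : 0 < 1 - δ := sub_pos.2 hδ
  set ℓ := Real.posLog (lam / (2 * Real.pi))
  have hℓ : 0 ≤ ℓ := Real.posLog_nonneg
  have hx : 0 < lam / (2 * Real.pi) := by positivity
  have h1 : t / ((1 - δ) * lam) * ℓ ≤ σ ^ 2 := by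
    have h2 := pow_le_pow_left₀ (by positivity) h 2
    rw [mul_pow, Real.sq_sqrt (by positivity)] at h2
    -- Of `(1 + √ℓ)²` only the term `ℓ` is kept.
    refine le_trans (mul_le_mul_of_nonneg_left ?_ (by positivity)) h2
    have h3 := Real.sq_sqrt hℓ
    have h4 := Real.sqrt_nonneg ℓ
    nlinarith
  have h2 : t * ℓ ≤ σ ^ 2 * ((1 - δ) * lam) := by
    rwa [div_mul_eq_mul_div, div_le_iff₀ (by positivity)] at h1
  have h3 : ℓ / 2 ≤ (1 - δ) * L / (2 * (t / σ ^ 2)) := by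
    rw [le_div_iff₀ (by positivity)]
    calc ℓ / 2 * (2 * (t / σ ^ 2)) = t * ℓ / σ ^ 2 := by ring
      _ ≤ (1 - δ) * lam := by rw [div_le_iff₀ (by positivity)]; linarith
      _ ≤ (1 - δ) * L := mul_le_mul_of_nonneg_left hL hδ'.le
  calc _ ≤ Real.exp (-(Real.log (lam / (2 * Real.pi)) / 2)) :=
        Real.exp_le_exp.2 (by linarith [show Real.log (lam / (2 * Real.pi)) ≤ ℓ from le_max_right _ _])
    _ = (√(lam / (2 * Real.pi)))⁻¹ := by
        rw [Real.exp_neg, ← Real.log_sqrt hx.le, Real.exp_log (Real.sqrt_pos.2 hx)]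
    _ = _ := by rw [Real.sqrt_div hlam.le, inv_div]

/-- Under the singular value condition, some well-balanced linear rule recovers the most likely label
of every topic up to an error of order `1 / √λ`. -/
lemma exists_wellBalanced_dropoutErr_le {c : Fin T → Bool} (hδ : δ < 1)
    (hrank : M.wordMatrix.rank = T)
    (hσ : √(T / ((1 - δ) * M.minLength)) * (1 + √(Real.posLog (M.minLength / (2 * Real.pi))))
        ≤ M.minSingularValue) :
    ∃ w, M.WellBalanced (T / M.minSingularValue ^ 2) w ∧
      M.dropoutErr δ w ≤ M.errMin δ c + √(2 * Real.pi) / √M.minLength := by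
  have := M.nonempty_topic
  have hT : (0 : ℝ) < T := Nat.cast_pos.2 (Fin.pos_iff_nonempty.2 this)
  have hσ0 := minSingularValue_pos hrank
  set s : Fin T → ℝ := fun τ => if c τ then 1 else -1 with hs
  have hs2 (τ : Fin T) : s τ ^ 2 = 1 := by simp only [hs]; split_ifs <;> norm_num
  obtain ⟨w, hw, hnorm⟩ := M.wordMatrix.exists_transpose_mulVec_eq hrank s
  replace hnorm : ∑ j, w j ^ 2 ≤ T / M.minSingularValue ^ 2 := by
    rw [le_div_iff₀ (by positivity), mul_comm]
    simpa [hs2, minSingularValue] using hnorm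
  -- A topic of length zero would have a zero column in `wordMatrix` (division by zero gives zero),
  -- contradicting `Πᵀ w = s` with `s τ = ±1`.
  have hL (τ : Fin T) : 0 < M.topicLength τ := by
    refine (topicLength_nonneg τ).lt_of_ne fun h0 => ?_
    have h1 := hw τ
    have h2 := hs2 τ
    simp [wordMatrix, ← h0] at h1
    simp [← h1] at h2
  have hmean (τ : Fin T) : ∑ j, M.rate τ j * w j = s τ * M.topicLength τ := by
    rw [← hw τ, Finset.sum_mul]
    refine Finset.sum_congr rfl fun j _ => ?_
    have := (hL τ).ne'
    simp only [wordMatrix, Matrix.of_apply]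
    field_simp
  have hwsq (j : Fin d) : w j ^ 2 ≤ T / M.minSingularValue ^ 2 :=
    (Finset.single_le_sum (f := fun j => w j ^ 2) (fun _ _ => sq_nonneg _)
      (Finset.mem_univ j)).trans hnorm
  have hmin : 0 < M.minLength := by
    obtain ⟨τ, hτ⟩ := exists_eq_ciInf_of_finite (f := M.topicLength)
    rw [minLength, ← hτ]
    exact hL τ
  refine ⟨w, fun τ => ?_, M.dropoutErr_le_errMin_add (by positivity) fun τ => ?_⟩
  · have hcs : M.topicLength τ ≤ ∑ j, (M.rate τ j : ℝ) * w j ^ 2 := by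
      have := Finset.sum_sq_le_sum_mul_sum_of_sq_le_mul Finset.univ
        (r := fun j => (M.rate τ j : ℝ) * w j) (f := fun j => (M.rate τ j : ℝ))
        (g := fun j => (M.rate τ j : ℝ) * w j ^ 2) (fun j _ => NNReal.coe_nonneg _)
        (fun j _ => by positivity) fun j _ => by
          ring_nf; exact le_rfl
      rw [hmean, mul_pow, hs2, one_mul, ← topicLength, sq] at this
      exact le_of_mul_le_mul_left this (hL τ)
    have hpos := (hL τ).trans_le hcs
    refine ⟨hpos, (div_le_iff₀ hpos).2 ?_⟩
    exact mul_le_mul (Real.iSup_le hwsq (by positivity)) hcs (hL τ).le (by positivity)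
  · set b := √(T / M.minSingularValue ^ 2) with hb
    have hb2 : b ^ 2 = T / M.minSingularValue ^ 2 := Real.sq_sqrt (by positivity)
    have hsub : {x | linearRule w x ≠ c τ} ⊆ {x | ∑ j, s τ * w j * (x j : ℝ) ≤ 0} := by
      intro x hx
      simp only [mul_assoc, ← Finset.mul_sum, Set.mem_ofPred_eq, linearRule, hs] at hx ⊢
      cases hcτ : c τ <;> simp [hcτ] at hx ⊢ <;> linarith
    have hchernoff := M.thinnedLaw_real_sum_nonpos_le δ τ (v := fun j => s τ * w j) (b := b)
      (Real.sqrt_pos.2 (by positivity))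
      (fun j => Real.abs_le_sqrt (by rw [mul_pow, hs2, one_mul]; exact hwsq j)) (by
        simp only [mul_left_comm _ (s τ), ← Finset.mul_sum, hmean]
        rw [← mul_assoc, ← sq, hs2, one_mul])
    rw [hb2] at hchernoff
    exact (measureReal_mono hsub).trans (hchernoff.trans
      (exp_neg_le_of_singular_value_bound hmin (minLength_le τ) hσ0 hT hδ hσ))

end PoissonTopicModel

theorem proposition2 :
    ∃ C : ℝ, ∀ (d T : ℕ) (M : PoissonTopicModel d T) (δ : unitInterval) (c : Fin T → Bool),
      0 < δ → δ < 1 →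
      (∀ τ, M.IsMostLikelyLabel δ τ (c τ)) →
      M.wordMatrix.rank = T →
      √(T / ((1 - δ) * M.minLength)) * (1 + √(Real.posLog (M.minLength / (2 * Real.pi))))
        ≤ M.minSingularValue →
      M.DistinctTopics δ c Set.univ C ∧
        ∀ κ : ℝ, 0 < κ →
          (T / M.minSingularValue ^ 2 ≤ κ ∨
            ∃ w, M.WellBalanced κ w ∧ IsMinOn (M.dropoutErr δ) Set.univ w) →
          M.DistinctTopics δ c {w | M.WellBalanced κ w} C := by
  refine ⟨√(2 * Real.pi), fun d T M δ c _ hδ hc hrank hσ => ?_⟩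
  obtain ⟨w₀, hbal, herr⟩ := PoissonTopicModel.exists_wellBalanced_dropoutErr_le hδ hrank hσ
  refine ⟨PoissonTopicModel.distinctTopics_of_mem hc (Set.mem_univ w₀) herr, fun κ _ hκ => ?_⟩
  rcases hκ with hκ | ⟨w, hw, hmin⟩
  · exact PoissonTopicModel.distinctTopics_of_mem hc (hbal.mono hκ) herr
  -- Here `w₀` need not be `κ`-well-balanced; the global minimizer `w` is, and its error is no
  -- larger than that of `w₀`.
  · exact PoissonTopicModel.distinctTopics_of_mem hc hw ((hmin (Set.mem_univ w₀)).trans herr)
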